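/- For a probability density $f$ on $\mathbb{R}$ that is differentiable with locally absolutely continuous derivative (so that $f''$ exists almost everywhere and is the second distributional derivative of $f$), let \[ J(f)=\int_{\{f>0\}}\left[\left(\frac{f'(x)}{f(x)}\right)^2-\frac{f''(x)}{f(x)}\right]^2 f(x)\,dx\in[0,\infty]. \] For a real random variable $X$ put $J(X)=J(f)$ if $X$ has such a density $f$ (it is then unique), and $J(X)=\infty$ otherwise. A function $f\ge 0$ on $\mathbb{R}$ is log-concave if $f=e^{-\Phi}$ for some convex $\Phi:\mathbb{R}\to\mathbb{R}\cup\{+\infty\}$. Let $X$ and $Y$ be independent real random variables with log-concave probability densities such that $J(X)<\infty$ and $J(Y)<\infty$. Then $J(X)$, $J(Y)$ and $J(X+Y)$ are positive, $J(X+Y)$ is finite, and \[ \frac 1{\sqrt{J(X+Y)}}\ \ge\ \frac 1{\sqrt{J(X)}}+\frac 1{\sqrt{J(Y)}}. \] Moreover, equality holds if and only if $X$ and $Y$ are both Gaussian, with arbitrary means and arbitrary positive variances. -/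

import Mathlib

open MeasureTheory ProbabilityTheory
open scoped ENNReal NNReal

/-- A nonnegative function `f` on the line is log-concave: `f = exp (-Φ)` with `Φ` convex, where
`Φ` may take the value `+∞` (that is, `f` may vanish). The conventions `0 ^ 0 = 1` and `0 ^ t = 0`
for `t > 0` make the inequality correct at points where `f` vanishes. -/
def LogConcave (f : ℝ → ℝ) : Prop :=
  (∀ x, 0 ≤ f x) ∧
    ∀ x y s t : ℝ, 0 ≤ s → 0 ≤ t → s + t = 1 → f x ^ s * f y ^ t ≤ f (s * x + t * y)

/-- `f` is a density of the measure `μ` with respect to Lebesgue measure. -/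
def IsDensityOf (f : ℝ → ℝ) (μ : Measure ℝ) : Prop :=
  (∀ x, 0 ≤ f x) ∧ Measurable f ∧ μ = volume.withDensity (fun x => ENNReal.ofReal (f x))

/-- `f` is differentiable and its derivative is locally absolutely continuous, so that `f''` exists
almost everywhere, is locally integrable, and is the second distributional derivative of `f`.
(Equivalently, `f` is the continuous representative of an element of `W^{2,1}_loc`.) -/
def TwiceDiffAC (f : ℝ → ℝ) : Prop :=
  Differentiable ℝ f ∧ ∀ a b : ℝ, AbsolutelyContinuousOnInterval (deriv f) a b

/-- The functional `J(f) = ∫_{f > 0} [(f'/f)² - f''/f]² f dx`, with values in `[0, ∞]`. -/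
noncomputable def entropyProductionDensity (f : ℝ → ℝ) : ℝ≥0∞ :=
  ∫⁻ x in {x | 0 < f x},
    ENNReal.ofReal (((deriv f x / f x) ^ 2 - deriv (deriv f) x / f x) ^ 2 * f x)

/-- `J` of a law on the line: `J(f)` for the density `f` of the law that has two derivatives in the
sense of `TwiceDiffAC`, and `∞` when the law has no such density. Such a density is unique, so the
infimum is over at most one function. -/
noncomputable def entropyProduction (μ : Measure ℝ) : ℝ≥0∞ :=
  ⨅ (f : ℝ → ℝ) (_ : IsDensityOf f μ ∧ TwiceDiffAC f), entropyProductionDensity f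

theorem IsDensityOf.eq_of_twiceDiffAC {f g : ℝ → ℝ} {μ : Measure ℝ} [IsFiniteMeasure μ]
    (hf : IsDensityOf f μ) (hg : IsDensityOf g μ) (hf' : TwiceDiffAC f) (hg' : TwiceDiffAC g) :
    f = g := by
  obtain ⟨hf0, hfm, hfμ⟩ := hf
  obtain ⟨hg0, hgm, hgμ⟩ := hg
  have h : (fun x => ENNReal.ofReal (f x)) =ᵐ[volume] fun x => ENNReal.ofReal (g x) := by
    refine (withDensity_eq_iff hfm.ennreal_ofReal.aemeasurable hgm.ennreal_ofReal.aemeasurable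
      ?_).1 (hfμ.symm.trans hgμ)
    have := measure_ne_top μ Set.univ
    rw [hfμ, withDensity_apply _ MeasurableSet.univ] at this
    simpa using this
  refine Continuous.ae_eq_iff_eq volume hf'.1.continuous hg'.1.continuous |>.1 ?_
  filter_upwards [h] with x hx
  exact (ENNReal.ofReal_eq_ofReal_iff (hf0 x) (hg0 x)).1 hx

theorem entropyProduction_eq {f : ℝ → ℝ} {μ : Measure ℝ} [IsFiniteMeasure μ]
    (hf : IsDensityOf f μ) (hf' : TwiceDiffAC f) :
    entropyProduction μ = entropyProductionDensity f := by
  refine le_antisymm (iInf₂_le f ⟨hf, hf'⟩) (le_iInf₂ fun g hg => ?_)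
  rw [hf.eq_of_twiceDiffAC hg.1 hf' hg.2]

/-! Write `φ_f = -(log f)''` and `ρ_f = f'/f`, so that `J(f) = ∫ φ_f² f`, and let `h = f * g` be the
density of `Z = X + Y`. A derivative of `h` may be put on either factor. Hence, for `a + b = 1`, the
score `ρ_h(z)` is the conditional mean of `a ρ_f(X) + b ρ_g(Y)` given `Z = z`, and `φ_h(z)` equals
`E[a² φ_f(X) + b² φ_g(Y) | Z = z]` minus the conditional variance of `a ρ_f(X) + b ρ_g(Y)`. Dropping
the variance gives an upper bound for `φ_h` (`negLogDeriv₂_lineConv_le`).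

Log-concavity passes to `h`, so `φ_h ≥ 0` and the bound may be squared. Jensen and independence then
give `J(h) ≤ a⁴ J(f) + 2a²b² I(f) I(g) + b⁴ J(g)` with `I(f) = ∫ φ_f f ≤ √J(f)`
(`integral_sq_lineConv_le`). The right side is at most `(a² √J(f) + b² √J(g))²`, and the best `a`
gives the inequality (`one_div_add_one_div_le`).

Equality forces `I(f) = √J(f)` and `I(g) = √J(g)`. Then `φ_f` has zero variance under `f`, so it is
constant where `f > 0`, and `f` is Gaussian (`exists_eq_gaussianPDFReal`); likewise `g`.

The analysis rests on `J(f) < ∞` and `φ_f ≥ 0`: they make `∫ f'²/f` finite, hence `f'` and `f''`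
integrable and `f`, `f'` bounded, which justifies every manipulation of the convolution. -/

open Filter Set Topology

/-! ### Absolutely continuous and integrable functions on the line -/

/-- `u` is locally absolutely continuous on the line. -/
def LocallyAC (u : ℝ → ℝ) : Prop := ∀ a b : ℝ, AbsolutelyContinuousOnInterval u a b

/-- A zero with nonzero derivative is an isolated zero, and only countably many points of a set are
isolated in it from the right. No regularity is needed, because `deriv` is 0 where `u` is not
differentiable. -/
theorem ae_deriv_eq_zero_of_eq_zero (u : ℝ → ℝ) : ∀ᵐ x, u x = 0 → deriv u x = 0 := by
  have hc : {x ∈ {x | u x = 0} | 𝓝[{x | u x = 0} ∩ Ioi x] x = ⊥}.Countable :=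
    countable_setOfPred_isolated_right_within
  filter_upwards [measure_eq_zero_iff_ae_notMem.1 (hc.measure_zero volume)] with x hx hux
  by_contra hne
  have hd : HasDerivAt u (deriv u x) x := (differentiableAt_of_deriv_ne_zero hne).hasDerivAt
  refine hx ⟨hux, ?_⟩
  rw [← empty_mem_iff_bot]
  have h1 : ∀ᶠ z in 𝓝[≠] x, u z ≠ u x := hd.eventually_ne hne
  have h2 : 𝓝[{x | u x = 0} ∩ Ioi x] x ≤ 𝓝[≠] x :=
    nhdsWithin_mono _ fun z hz => ne_of_gt hz.2
  filter_upwards [h2 h1, self_mem_nhdsWithin] with z hz hz'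
  exact hz (hz'.1.trans hux.symm)

theorem deriv_eq_zero_of_nonneg_of_eq_zero {f : ℝ → ℝ} (hf : ∀ x, 0 ≤ f x) {x : ℝ}
    (hx : f x = 0) : deriv f x = 0 :=
  IsLocalMin.deriv_eq_zero (Eventually.of_forall fun y => by rw [hx]; exact hf y)

namespace LocallyAC

variable {u v : ℝ → ℝ}

theorem ae_hasDerivAt (hu : LocallyAC u) : ∀ᵐ x, HasDerivAt u (deriv u x) x := by
  have : ∀ n : ℕ, ∀ᵐ x : ℝ, x ∈ uIcc (-(n : ℝ)) n → DifferentiableAt ℝ u x :=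
    fun n => (hu _ _).ae_differentiableAt
  filter_upwards [ae_all_iff.2 this] with x hx
  obtain ⟨n, hn⟩ := exists_nat_ge |x|
  refine (hx n ?_).hasDerivAt
  rw [uIcc_of_le (by linarith [abs_nonneg x])]
  exact abs_le.1 hn

theorem continuous (hu : LocallyAC u) : Continuous u := by
  refine continuous_iff_continuousAt.2 fun x => ?_
  refine (hu (x - 1) (x + 1)).continuousOn.continuousAt ?_
  rw [uIcc_of_le (by linarith)]
  exact Icc_mem_nhds (by linarith) (by linarith)

theorem integral_deriv (hu : LocallyAC u) (a b : ℝ) : ∫ x in a..b, deriv u x = u b - u a :=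
  (hu a b).integral_deriv_eq_sub

theorem of_forall_integral {w : ℝ → ℝ} (hw : ∀ a b, IntervalIntegrable w volume a b)
    (h : ∀ x, u x = u 0 + ∫ t in (0 : ℝ)..x, w t) : LocallyAC u := by
  intro a b
  have h1 : ∀ x, u x = (∫ t in a..x, w t) + u a := by
    intro x
    have := intervalIntegral.integral_add_adjacent_intervals (hw 0 a) (hw a x)
    rw [h x, h a]
    linarith
  have h2 : AbsolutelyContinuousOnInterval (fun _ : ℝ => u a) a b :=
    (LipschitzWith.const (u a)).lipschitzOnWith.absolutelyContinuousOnInterval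
  have h3 := ((hw a b).absolutelyContinuousOnInterval_intervalIntegral (c := a) (by simp)).add h2
  rw [show u = fun x => (∫ t in a..x, w t) + u a from funext h1]
  exact h3

theorem comp_const_sub (hu : LocallyAC u) (z : ℝ) : LocallyAC (fun y => u (z - y)) := by
  refine of_forall_integral (w := fun y => - deriv u (z - y)) (fun a b => ?_) fun x => ?_
  · have := (hu (z - a) (z - b)).intervalIntegrable_deriv.comp_sub_left z
    simpa [Pi.neg_def] using this.neg
  · rw [intervalIntegral.integral_neg, intervalIntegral.integral_comp_sub_left,
      hu.integral_deriv]
    simp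

theorem mul (hu : LocallyAC u) (hv : LocallyAC v) : LocallyAC (fun y => u y * v y) :=
  fun a b => (hu a b).mul (hv a b)

theorem of_contDiff (hu : ContDiff ℝ 1 u) : LocallyAC u :=
  fun _ _ => hu.contDiffOn.absolutelyContinuousOnInterval

theorem abs_le (hu : LocallyAC u) (hi : Integrable (deriv u)) (x : ℝ) :
    |u x| ≤ |u 0| + ∫ t, |deriv u t| := by
  have h1 : u x = u 0 + ∫ t in (0 : ℝ)..x, deriv u t := by rw [hu.integral_deriv]; ring
  have h2 : |∫ t in (0 : ℝ)..x, deriv u t| ≤ ∫ t, |deriv u t| := by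
    rw [← Real.norm_eq_abs]
    refine (intervalIntegral.norm_integral_le_integral_norm_uIoc).trans ?_
    exact setIntegral_le_integral hi.norm (Eventually.of_forall fun _ => norm_nonneg _)
  calc |u x| = |u 0 + ∫ t in (0 : ℝ)..x, deriv u t| := by rw [← h1]
    _ ≤ _ := (abs_add_le _ _).trans (by linarith)

theorem exists_bound (hu : LocallyAC u) (hi : Integrable (deriv u)) : ∃ C, ∀ x, |u x| ≤ C :=
  ⟨_, hu.abs_le hi⟩

theorem _root_.MeasureTheory.Integrable.exists_abs_lt {u : ℝ → ℝ} (hi : Integrable u) {ε : ℝ}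
    (hε : 0 < ε) (B : ℝ) : (∃ x ≥ B, |u x| < ε) ∧ ∃ x ≤ B, |u x| < ε := by
  constructor
  · by_contra! h
    have : IntegrableOn (fun _ : ℝ => ε) (Ici B) := by
      refine Integrable.mono' hi.norm.integrableOn (by fun_prop) ?_
      filter_upwards [ae_restrict_mem measurableSet_Ici] with x hx
      rw [Real.norm_of_nonneg hε.le]
      exact h x hx
    rw [integrableOn_const_iff] at this
    simp [hε.ne'] at this
  · by_contra! h
    have : IntegrableOn (fun _ : ℝ => ε) (Iic B) := by
      refine Integrable.mono' hi.norm.integrableOn (by fun_prop) ?_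
      filter_upwards [ae_restrict_mem measurableSet_Iic] with x hx
      rw [Real.norm_of_nonneg hε.le]
      exact h x hx
    rw [integrableOn_const_iff] at this
    simp [hε.ne'] at this

/-- Integrability of `u` yields endpoints tending to `±∞` along which `u` tends to 0; the boundary
terms vanish along them. -/
theorem integral_deriv_eq_zero (hu : LocallyAC u) (hi : Integrable u)
    (hi' : Integrable (deriv u)) : ∫ x, deriv u x = 0 := by
  have hpos : ∀ n : ℕ, (0 : ℝ) < 1 / (n + 1) := fun n => Nat.one_div_pos_of_nat
  choose b hb hub using fun n : ℕ => (hi.exists_abs_lt (hpos n) n).1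
  choose a ha hua using fun n : ℕ => (hi.exists_abs_lt (hpos n) (-n)).2
  have hbt : Tendsto b atTop atTop := tendsto_atTop_mono hb tendsto_natCast_atTop_atTop
  have hat : Tendsto a atTop atBot :=
    tendsto_atBot_mono ha (tendsto_neg_atTop_atBot.comp tendsto_natCast_atTop_atTop)
  have h1 := intervalIntegral_tendsto_integral hi' hat hbt
  have hz : Tendsto (fun n : ℕ => 1 / ((n : ℝ) + 1)) atTop (𝓝 0) :=
    tendsto_one_div_add_atTop_nhds_zero_nat
  have hub0 : Tendsto (fun n => u (b n)) atTop (𝓝 0) :=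
    squeeze_zero_norm (fun n => (hub n).le) hz
  have hua0 : Tendsto (fun n => u (a n)) atTop (𝓝 0) :=
    squeeze_zero_norm (fun n => (hua n).le) hz
  have h2 := hub0.sub hua0
  simp only [hu.integral_deriv, sub_zero] at h1 h2
  exact tendsto_nhds_unique h1 h2

end LocallyAC

/-- Otherwise `f` increases strictly beyond `B` and stays above a positive constant, against
integrability. This gives boundary terms of a favourable sign without any decay of `f'`. -/
theorem MeasureTheory.Integrable.exists_ge_deriv_nonpos {f : ℝ → ℝ} (hi : Integrable f)
    (hd : Differentiable ℝ f) (h0 : ∀ x, 0 ≤ f x) (B : ℝ) : ∃ b ≥ B, deriv f b ≤ 0 := by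
  by_contra! h
  have hm : StrictMonoOn f (Ici B) :=
    strictMonoOn_of_deriv_pos (convex_Ici B) hd.continuous.continuousOn fun x hx =>
      h x (by rw [interior_Ici] at hx; exact le_of_lt hx)
  have hlt : f B < f (B + 1) := hm (by simp) (by simp) (by linarith)
  obtain ⟨x, hx, hxl⟩ := (hi.exists_abs_lt ((h0 B).trans_lt hlt) (B + 1)).1
  have hge : B + 1 ≤ x := hx
  have := hm.monotoneOn (a := B + 1) (by simp) (show B ≤ x by linarith) hge
  rw [abs_of_nonneg (h0 x)] at hxl
  linarith

theorem MeasureTheory.Integrable.exists_le_deriv_nonneg {f : ℝ → ℝ} (hi : Integrable f)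
    (hd : Differentiable ℝ f) (h0 : ∀ x, 0 ≤ f x) (B : ℝ) : ∃ a ≤ B, 0 ≤ deriv f a := by
  obtain ⟨b, hb, hfb⟩ := hi.comp_neg.exists_ge_deriv_nonpos
    (hd.comp differentiable_neg) (fun x => h0 (-x)) (-B)
  refine ⟨-b, by linarith, ?_⟩
  have := deriv_comp_neg f b
  linarith

/-! ### Regular densities: Fisher information and integrability of derivatives -/

/-- The function `-(log f)''`, written as `(f' / f)² - f'' / f`. -/
noncomputable def negLogDeriv₂ (f : ℝ → ℝ) (x : ℝ) : ℝ :=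
  (deriv f x / f x) ^ 2 - deriv (deriv f) x / f x

/-- A twice differentiable probability density with `-(log f)'' ≥ 0` almost everywhere and with
finite entropy production. -/
structure IsRegularDensity (f : ℝ → ℝ) : Prop where
  nonneg : ∀ x, 0 ≤ f x
  integrable : Integrable f
  integral_eq_one : ∫ x, f x = 1
  twiceDiffAC : TwiceDiffAC f
  negLogDeriv₂_nonneg : ∀ᵐ x, 0 ≤ negLogDeriv₂ f x
  lt_top : entropyProductionDensity f < ⊤

theorem entropyProductionDensity_eq {f : ℝ → ℝ} (hf : ∀ x, 0 ≤ f x) (hm : Measurable f) :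
    entropyProductionDensity f = ∫⁻ x, ENNReal.ofReal (negLogDeriv₂ f x ^ 2 * f x) := by
  have hs : MeasurableSet {x | 0 < f x} := measurableSet_lt measurable_const hm
  rw [entropyProductionDensity, ← lintegral_indicator hs]
  refine lintegral_congr fun x => ?_
  by_cases h : 0 < f x
  · rw [indicator_of_mem (show x ∈ {x | 0 < f x} from h)]
    rfl
  · rw [indicator_of_notMem (show x ∉ {x | 0 < f x} from h), le_antisymm (not_lt.1 h) (hf x)]
    simp

theorem measurable_negLogDeriv₂ {f : ℝ → ℝ} (hm : Measurable f) :
    Measurable (negLogDeriv₂ f) :=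
  (((measurable_deriv f).div hm).pow_const 2).sub ((measurable_deriv _).div hm)

namespace IsRegularDensity

variable {f : ℝ → ℝ}

theorem differentiable (hf : IsRegularDensity f) : Differentiable ℝ f := hf.twiceDiffAC.1

theorem hasDerivAt (hf : IsRegularDensity f) (x : ℝ) : HasDerivAt f (deriv f x) x :=
  (hf.differentiable x).hasDerivAt

theorem locallyAC_deriv (hf : IsRegularDensity f) : LocallyAC (deriv f) := hf.twiceDiffAC.2

theorem continuous_deriv (hf : IsRegularDensity f) : Continuous (deriv f) :=
  hf.locallyAC_deriv.continuous

theorem locallyAC (hf : IsRegularDensity f) : LocallyAC f :=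
  .of_contDiff (contDiff_one_iff_deriv.2 ⟨hf.differentiable, hf.continuous_deriv⟩)

theorem continuous (hf : IsRegularDensity f) : Continuous f := hf.differentiable.continuous

theorem measurable (hf : IsRegularDensity f) : Measurable f := hf.continuous.measurable

theorem deriv_eq_zero (hf : IsRegularDensity f) {x : ℝ} (hx : f x = 0) : deriv f x = 0 :=
  deriv_eq_zero_of_nonneg_of_eq_zero hf.nonneg hx

/-- The issue is the zeros of `f`, where quotients take the value 0. There `f` is minimal, so `f' =
0`, and `f'' = 0` at almost every zero of `f'`. -/
theorem ae_negLogDeriv₂_mul (hf : IsRegularDensity f) :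
    ∀ᵐ x, negLogDeriv₂ f x * f x = deriv f x ^ 2 / f x - deriv (deriv f) x := by
  filter_upwards [ae_deriv_eq_zero_of_eq_zero (deriv f)] with x hx
  by_cases h : f x = 0
  · simp [h, hx (hf.deriv_eq_zero h)]
  · rw [negLogDeriv₂]
    field_simp

theorem integrable_sq (hf : IsRegularDensity f) :
    Integrable fun x => negLogDeriv₂ f x ^ 2 * f x := by
  have hm := measurable_negLogDeriv₂ hf.measurable
  have h0 : ∀ x, 0 ≤ negLogDeriv₂ f x ^ 2 * f x := fun x => mul_nonneg (sq_nonneg _) (hf.nonneg x)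
  refine ⟨((hm.pow_const 2).mul hf.measurable).aestronglyMeasurable, ?_⟩
  rw [hasFiniteIntegral_iff_ofReal (Eventually.of_forall h0),
    ← entropyProductionDensity_eq hf.nonneg hf.measurable]
  exact hf.lt_top

theorem entropyProductionDensity_eq_ofReal (hf : IsRegularDensity f) :
    entropyProductionDensity f = ENNReal.ofReal (∫ x, negLogDeriv₂ f x ^ 2 * f x) := by
  rw [entropyProductionDensity_eq hf.nonneg hf.measurable,
    ofReal_integral_eq_lintegral_ofReal hf.integrable_sq
      (Eventually.of_forall fun x => mul_nonneg (sq_nonneg _) (hf.nonneg x))]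

theorem integrable_negLogDeriv₂_mul (hf : IsRegularDensity f) :
    Integrable fun x => negLogDeriv₂ f x * f x := by
  have hm := measurable_negLogDeriv₂ hf.measurable
  refine Integrable.mono' (hf.integrable_sq.add hf.integrable)
    (hm.mul hf.measurable).aestronglyMeasurable (Eventually.of_forall fun x => ?_)
  rw [Real.norm_eq_abs, abs_mul, abs_of_nonneg (hf.nonneg x)]
  have h1 := hf.nonneg x
  have h2 : |negLogDeriv₂ f x| ≤ negLogDeriv₂ f x ^ 2 + 1 := by
    rw [← sq_abs]; nlinarith [sq_nonneg (|negLogDeriv₂ f x| - 1), abs_nonneg (negLogDeriv₂ f x)]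
  calc _ ≤ (negLogDeriv₂ f x ^ 2 + 1) * f x := by gcongr
    _ = _ := by simp only [Pi.add_apply]; ring

theorem integral_negLogDeriv₂_mul_nonneg (hf : IsRegularDensity f) :
    0 ≤ ∫ x, negLogDeriv₂ f x * f x :=
  integral_nonneg_of_ae (hf.negLogDeriv₂_nonneg.mono fun x hx => mul_nonneg hx (hf.nonneg x))

theorem integral_sub_sq_mul (hf : IsRegularDensity f) (c : ℝ) :
    Integrable (fun x => (negLogDeriv₂ f x - c) ^ 2 * f x) ∧
    ∫ x, (negLogDeriv₂ f x - c) ^ 2 * f x =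
      (∫ x, negLogDeriv₂ f x ^ 2 * f x) - 2 * c * (∫ x, negLogDeriv₂ f x * f x) + c ^ 2 := by
  have h : (fun x => (negLogDeriv₂ f x - c) ^ 2 * f x) = fun x =>
      negLogDeriv₂ f x ^ 2 * f x - 2 * c * (negLogDeriv₂ f x * f x) + c ^ 2 * f x := by
    ext x; ring
  have h1 := hf.integrable_sq
  have h2 := hf.integrable_negLogDeriv₂_mul.const_mul (2 * c)
  have h3 := hf.integrable.const_mul (c ^ 2)
  have h12 : Integrable fun x =>
      negLogDeriv₂ f x ^ 2 * f x - 2 * c * (negLogDeriv₂ f x * f x) := h1.sub h2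
  rw [h]
  refine ⟨h12.add h3, ?_⟩
  rw [integral_add h12 h3, integral_sub h1 h2, integral_const_mul, integral_const_mul,
    hf.integral_eq_one, mul_one]

theorem sq_integral_le (hf : IsRegularDensity f) :
    (∫ x, negLogDeriv₂ f x * f x) ^ 2 ≤ ∫ x, negLogDeriv₂ f x ^ 2 * f x := by
  have h : 0 ≤ ∫ x, (negLogDeriv₂ f x - ∫ x, negLogDeriv₂ f x * f x) ^ 2 * f x :=
    integral_nonneg fun x => mul_nonneg (sq_nonneg _) (hf.nonneg x)
  rw [(hf.integral_sub_sq_mul _).2] at h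
  linarith

/-- Integrating `f'²/f = φ_f f + f''` over `[a, b]` leaves the boundary term `f'(b) - f'(a)`. It is
nonpositive for suitable `a → -∞` and `b → ∞`, and `φ_f ≥ 0` bounds the rest by the integral over
the line. -/
theorem integrable_and_integral_deriv_sq_div_le (hf : IsRegularDensity f) :
    Integrable (fun x => deriv f x ^ 2 / f x) ∧
      ∫ x, deriv f x ^ 2 / f x ≤ ∫ x, negLogDeriv₂ f x * f x := by
  have h0 : ∀ x, 0 ≤ deriv f x ^ 2 / f x := fun x => div_nonneg (sq_nonneg _) (hf.nonneg x)
  have hae : (fun x => deriv f x ^ 2 / f x) =ᵐ[volume]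
      fun x => negLogDeriv₂ f x * f x + deriv (deriv f) x := by
    filter_upwards [hf.ae_negLogDeriv₂_mul] with x hx
    rw [hx]; ring
  have hi1 : ∀ a b, IntervalIntegrable (fun x => negLogDeriv₂ f x * f x) volume a b :=
    fun a b => hf.integrable_negLogDeriv₂_mul.intervalIntegrable
  have hi2 : ∀ a b, IntervalIntegrable (deriv (deriv f)) volume a b :=
    fun a b => (hf.locallyAC_deriv a b).intervalIntegrable_deriv
  have hi : ∀ a b, IntervalIntegrable (fun x => deriv f x ^ 2 / f x) volume a b := fun a b =>
    ((hi1 a b).add (hi2 a b)).congr_ae (ae_restrict_of_ae hae.symm)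
  choose b hb hfb using fun n : ℕ =>
    hf.integrable.exists_ge_deriv_nonpos hf.differentiable hf.nonneg n
  choose a ha hfa using fun n : ℕ =>
    hf.integrable.exists_le_deriv_nonneg hf.differentiable hf.nonneg (-n)
  have hbt : Tendsto b atTop atTop := tendsto_atTop_mono hb tendsto_natCast_atTop_atTop
  have hat : Tendsto a atTop atBot :=
    tendsto_atBot_mono ha (tendsto_neg_atTop_atBot.comp tendsto_natCast_atTop_atTop)
  have hab : ∀ n, a n ≤ b n := fun n => by
    have h1 := ha n
    have h2 := hb n
    have : (0 : ℝ) ≤ n := n.cast_nonneg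
    linarith
  have hle : ∀ n, ∫ x in a n..b n, deriv f x ^ 2 / f x ≤ ∫ x, negLogDeriv₂ f x * f x := by
    intro n
    rw [intervalIntegral.integral_congr_ae (hae.mono fun x hx _ => hx),
      intervalIntegral.integral_add (hi1 _ _) (hi2 _ _), hf.locallyAC_deriv.integral_deriv,
      intervalIntegral.integral_of_le (hab n)]
    have := setIntegral_le_integral (s := Ioc (a n) (b n)) hf.integrable_negLogDeriv₂_mul
      (hf.negLogDeriv₂_nonneg.mono fun x hx => mul_nonneg hx (hf.nonneg x))
    linarith [hfa n, hfb n]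
  have hint : Integrable (fun x => deriv f x ^ 2 / f x) := by
    refine integrable_of_intervalIntegral_norm_bounded (μ := volume)
      (∫ x, negLogDeriv₂ f x * f x) (fun n => ?_) hat hbt (Eventually.of_forall fun n => ?_)
    · exact (intervalIntegrable_iff_integrableOn_Ioc_of_le (hab n)).1 (hi _ _)
    · simpa only [Real.norm_of_nonneg (h0 _)] using hle n
  exact ⟨hint, le_of_tendsto' (intervalIntegral_tendsto_integral hint hat hbt) hle⟩

theorem integrable_deriv_sq_div (hf : IsRegularDensity f) :
    Integrable (fun x => deriv f x ^ 2 / f x) :=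
  hf.integrable_and_integral_deriv_sq_div_le.1

theorem integrable_deriv_deriv (hf : IsRegularDensity f) : Integrable (deriv (deriv f)) := by
  refine (hf.integrable_deriv_sq_div.sub hf.integrable_negLogDeriv₂_mul).congr ?_
  filter_upwards [hf.ae_negLogDeriv₂_mul] with x hx
  simp [hx]

theorem integrable_deriv (hf : IsRegularDensity f) : Integrable (deriv f) := by
  refine Integrable.mono' (hf.integrable_deriv_sq_div.add hf.integrable)
    (measurable_deriv f).aestronglyMeasurable (Eventually.of_forall fun x => ?_)
  rw [Real.norm_eq_abs, Pi.add_apply]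
  rcases (hf.nonneg x).eq_or_lt with h | h
  · simp [hf.deriv_eq_zero h.symm, ← h]
  · rw [div_add' _ _ _ h.ne', le_div_iff₀ h, ← sq_abs]
    nlinarith [sq_nonneg (|deriv f x| - f x), abs_nonneg (deriv f x),
      mul_nonneg (abs_nonneg (deriv f x)) h.le]

theorem exists_bound (hf : IsRegularDensity f) : ∃ C, ∀ x, |f x| ≤ C :=
  hf.locallyAC.exists_bound hf.integrable_deriv

theorem exists_bound_deriv (hf : IsRegularDensity f) : ∃ C, ∀ x, |deriv f x| ≤ C :=
  hf.locallyAC_deriv.exists_bound hf.integrable_deriv_deriv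

/-- If the integral were zero, then so would be `∫ φ_f f` by Cauchy–Schwarz, hence also the Fisher
information `∫ f'²/f`. Then `f` would be constant, which no probability density on the line is. -/
theorem integral_sq_pos (hf : IsRegularDensity f) : 0 < ∫ x, negLogDeriv₂ f x ^ 2 * f x := by
  have h0 : 0 ≤ ∫ x, negLogDeriv₂ f x ^ 2 * f x :=
    integral_nonneg fun x => mul_nonneg (sq_nonneg _) (hf.nonneg x)
  refine h0.lt_of_ne fun h => ?_
  have h1 : ∫ x, negLogDeriv₂ f x * f x = 0 := by
    have := hf.sq_integral_le
    rw [← h] at this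
    exact pow_eq_zero_iff two_ne_zero |>.1 (le_antisymm this (sq_nonneg _))
  obtain ⟨hi, hle⟩ := hf.integrable_and_integral_deriv_sq_div_le
  have hnn : ∀ x, 0 ≤ deriv f x ^ 2 / f x := fun x => div_nonneg (sq_nonneg _) (hf.nonneg x)
  have h2 := (integral_eq_zero_iff_of_nonneg hnn hi).1
    (le_antisymm (hle.trans h1.le) (integral_nonneg hnn))
  have h3 : deriv f =ᵐ[volume] fun _ => 0 := by
    filter_upwards [h2] with x hx
    by_cases hfx : f x = 0
    · exact hf.deriv_eq_zero hfx
    · simpa [hfx] using hx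
  have h4 : deriv f = fun _ => 0 :=
    (Continuous.ae_eq_iff_eq volume hf.continuous_deriv continuous_const).1 h3
  have h5 : ∀ x, f x = f 0 := fun x =>
    is_const_of_deriv_eq_zero hf.differentiable (fun x => congrFun h4 x) x 0
  have h6 : f 0 = 0 := by
    by_contra hne
    obtain ⟨x, -, hx⟩ := (hf.integrable.exists_abs_lt (abs_pos.2 hne) 0).1
    rw [h5 x] at hx
    exact lt_irrefl _ hx
  have := hf.integral_eq_one
  simp [h5, h6] at this

end IsRegularDensity

/-! ### Convolution and its derivatives -/

/-- The convolution of two functions on the line. -/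
noncomputable def lineConv (u v : ℝ → ℝ) (z : ℝ) : ℝ := ∫ y, u (z - y) * v y

theorem integrable_comp_sub_mul {u v : ℝ → ℝ} (hu : Measurable u) {C : ℝ} (hC : ∀ x, |u x| ≤ C)
    (hv : Integrable v) (z : ℝ) : Integrable fun y => u (z - y) * v y :=
  hv.bdd_mul (hu.comp (measurable_const.sub measurable_id)).aestronglyMeasurable
    (Eventually.of_forall fun y => hC (z - y))

theorem integrable_comp_sub_mul' {u v : ℝ → ℝ} (hu : Integrable u)
    (hv : Measurable v) {C : ℝ} (hC : ∀ x, |v x| ≤ C) (z : ℝ) :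
    Integrable fun y => u (z - y) * v y :=
  (hu.comp_sub_left z).mul_bdd hv.aestronglyMeasurable (Eventually.of_forall hC)

theorem hasDerivAt_lineConv {u v : ℝ → ℝ} (hu : Differentiable ℝ u) {C D : ℝ}
    (hC : ∀ x, |u x| ≤ C) (hD : ∀ x, |deriv u x| ≤ D) (hv : Integrable v) (z : ℝ) :
    HasDerivAt (lineConv u v) (lineConv (deriv u) v z) z := by
  have hm : Measurable (deriv u) := measurable_deriv u
  refine (hasDerivAt_integral_of_dominated_loc_of_deriv_le (s := univ)
    (F := fun z y => u (z - y) * v y) (F' := fun z y => deriv u (z - y) * v y)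
    (bound := fun y => D * |v y|) univ_mem
    (Eventually.of_forall fun z =>
      (integrable_comp_sub_mul hu.continuous.measurable hC hv z).aestronglyMeasurable)
    (integrable_comp_sub_mul hu.continuous.measurable hC hv z)
    (integrable_comp_sub_mul hm hD hv z).aestronglyMeasurable
    (Eventually.of_forall fun y x _ => ?_) (hv.norm.const_mul D)
    (Eventually.of_forall fun y x _ => ?_)).2
  · rw [Real.norm_eq_abs, abs_mul]
    gcongr
    exact hD _
  · exact (HasDerivAt.comp_sub_const x y (hu (x - y)).hasDerivAt).mul_const (v y)

/-- A derivative may be moved from one factor of a convolution to the other. -/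
theorem lineConv_deriv_comm {u v : ℝ → ℝ} (hu : LocallyAC u) (hv : LocallyAC v) {C D : ℝ}
    (hC : ∀ x, |u x| ≤ C) (hD : ∀ x, |v x| ≤ D) (hu' : Integrable (deriv u))
    (hv' : Integrable (deriv v)) (hvi : Integrable v) (z : ℝ) :
    lineConv (deriv u) v z = lineConv u (deriv v) z := by
  have hw := (hu.comp_const_sub z).mul hv
  have hae : deriv (fun y => u (z - y) * v y) =ᵐ[volume]
      fun y => u (z - y) * deriv v y - deriv u (z - y) * v y := by
    have h1 : ∀ᵐ y, HasDerivAt u (deriv u (z - y)) (z - y) :=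
      (Measure.measurePreserving_sub_left volume z).quasiMeasurePreserving.ae hu.ae_hasDerivAt
    filter_upwards [h1, hv.ae_hasDerivAt] with y hy1 hy2
    have := (HasDerivAt.comp_const_sub z y hy1).mul hy2
    refine this.deriv.trans ?_
    ring
  have i1 := integrable_comp_sub_mul hu.continuous.measurable hC hv' z
  have i2 := integrable_comp_sub_mul' hu' hv.continuous.measurable hD z
  have h := hw.integral_deriv_eq_zero
    (integrable_comp_sub_mul hu.continuous.measurable hC hvi z) ((i1.sub i2).congr hae.symm)
  rw [integral_congr_ae hae, integral_sub i1 i2] at h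
  exact (sub_eq_zero.1 h).symm

theorem integral_lineConv {u v : ℝ → ℝ} (hu : Integrable u) (hv : Integrable v) :
    (∀ᵐ z, Integrable fun y => u (z - y) * v y) ∧ Integrable (lineConv u v) ∧
      ∫ z, lineConv u v z = (∫ x, u x) * ∫ y, v y := by
  have heq : lineConv u v = convolution v u (ContinuousLinearMap.mul ℝ ℝ) volume := by
    ext z
    simp only [lineConv, convolution_def, ContinuousLinearMap.mul_apply']
    exact integral_congr_ae (Eventually.of_forall fun y => mul_comm _ _)
  refine ⟨?_, ?_, ?_⟩
  · filter_upwards [hv.ae_convolution_exists (ContinuousLinearMap.mul ℝ ℝ) hu] with z hz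
    refine Integrable.congr hz (Eventually.of_forall fun y => ?_)
    simp [mul_comm]
  · rw [heq]
    exact hv.integrable_convolution _ hu
  · rw [heq, integral_convolution _ hv hu, ContinuousLinearMap.mul_apply', mul_comm]

/-! ### Log-concavity and the variance inequality for the convolution -/

/-- The first-order form of log-concavity: `f' / f` is nonincreasing, cleared of denominators. -/
def HasAntitoneScore (f : ℝ → ℝ) : Prop := ∀ x y, x ≤ y → f x * deriv f y ≤ deriv f x * f y

namespace IsRegularDensity

variable {f g : ℝ → ℝ}

theorem hasDerivAt_lineConv (hf : IsRegularDensity f) (hg : IsRegularDensity g) (z : ℝ) :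
    HasDerivAt (lineConv f g) (lineConv (deriv f) g z) z := by
  obtain ⟨C, hC⟩ := hf.exists_bound
  obtain ⟨D, hD⟩ := hf.exists_bound_deriv
  exact _root_.hasDerivAt_lineConv hf.differentiable hC hD hg.integrable z

theorem lineConv_deriv (hf : IsRegularDensity f) (hg : IsRegularDensity g) (z : ℝ) :
    lineConv (deriv f) g z = lineConv f (deriv g) z := by
  obtain ⟨C, hC⟩ := hf.exists_bound
  obtain ⟨D, hD⟩ := hg.exists_bound
  exact lineConv_deriv_comm hf.locallyAC hg.locallyAC hC hD hf.integrable_deriv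
    hg.integrable_deriv hg.integrable z

/-- Together with its mirror image, this gives three expressions for the second derivative of the
convolution; the variance inequality combines them with weights `a²`, `2ab`, `b²`. -/
theorem lineConv_deriv_deriv_left (hf : IsRegularDensity f) (hg : IsRegularDensity g) (z : ℝ) :
    lineConv (deriv (deriv f)) g z = lineConv (deriv f) (deriv g) z := by
  obtain ⟨C, hC⟩ := hf.exists_bound_deriv
  obtain ⟨D, hD⟩ := hg.exists_bound
  exact lineConv_deriv_comm hf.locallyAC_deriv hg.locallyAC hC hD hf.integrable_deriv_deriv
    hg.integrable_deriv hg.integrable z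

theorem lineConv_deriv_deriv_right (hf : IsRegularDensity f) (hg : IsRegularDensity g) (z : ℝ) :
    lineConv f (deriv (deriv g)) z = lineConv (deriv f) (deriv g) z := by
  obtain ⟨C, hC⟩ := hf.exists_bound
  obtain ⟨D, hD⟩ := hg.exists_bound_deriv
  exact (lineConv_deriv_comm hf.locallyAC hg.locallyAC_deriv hC hD hf.integrable_deriv
    hg.integrable_deriv_deriv hg.integrable_deriv z).symm

theorem deriv_lineConv (hf : IsRegularDensity f) (hg : IsRegularDensity g) :
    deriv (lineConv f g) = lineConv f (deriv g) :=
  funext fun z => (hf.hasDerivAt_lineConv hg z).deriv.trans (hf.lineConv_deriv hg z)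

theorem hasDerivAt_deriv_lineConv (hf : IsRegularDensity f) (hg : IsRegularDensity g) (z : ℝ) :
    HasDerivAt (deriv (lineConv f g)) (lineConv (deriv f) (deriv g) z) z := by
  obtain ⟨C, hC⟩ := hf.exists_bound
  obtain ⟨D, hD⟩ := hf.exists_bound_deriv
  rw [hf.deriv_lineConv hg]
  exact _root_.hasDerivAt_lineConv hf.differentiable hC hD hg.integrable_deriv z

theorem deriv_deriv_lineConv (hf : IsRegularDensity f) (hg : IsRegularDensity g) :
    deriv (deriv (lineConv f g)) = lineConv (deriv f) (deriv g) :=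
  funext fun z => (hf.hasDerivAt_deriv_lineConv hg z).deriv

theorem lineConv_nonneg (hf : IsRegularDensity f) (hg : IsRegularDensity g) (z : ℝ) :
    0 ≤ lineConv f g z :=
  integral_nonneg fun _ => mul_nonneg (hf.nonneg _) (hg.nonneg _)

/-- The second derivative `f' * g'` is bounded by `sup |f'| · ∫ |g'|`, so the first derivative is
Lipschitz. -/
theorem twiceDiffAC_lineConv (hf : IsRegularDensity f) (hg : IsRegularDensity g) :
    TwiceDiffAC (lineConv f g) := by
  refine ⟨fun z => (hf.hasDerivAt_lineConv hg z).differentiableAt, ?_⟩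
  have hd : Differentiable ℝ (deriv (lineConv f g)) :=
    fun z => (hf.hasDerivAt_deriv_lineConv hg z).differentiableAt
  obtain ⟨D, hD⟩ := hf.exists_bound_deriv
  have hb : ∀ z, ‖deriv (deriv (lineConv f g)) z‖ ≤ D * ∫ y, |deriv g y| := by
    intro z
    rw [hf.deriv_deriv_lineConv hg, ← integral_const_mul]
    refine norm_integral_le_of_norm_le (hg.integrable_deriv.norm.const_mul D)
      (Eventually.of_forall fun y => ?_)
    rw [norm_mul]
    exact mul_le_mul_of_nonneg_right (hD _) (norm_nonneg _)
  have hnn : 0 ≤ D * ∫ y, |deriv g y| := (norm_nonneg _).trans (hb 0)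
  have hL : LipschitzWith (D * ∫ y, |deriv g y|).toNNReal (deriv (lineConv f g)) :=
    lipschitzWith_of_nnnorm_deriv_le hd fun z => by
      rw [← NNReal.coe_le_coe, Real.coe_toNNReal _ hnn]
      exact hb z
  exact fun a b => hL.lipschitzOnWith.absolutelyContinuousOnInterval

/-- Log-concavity of the convolution, by symmetrisation: `2 (h'² - h h'')` is a double integral over
`(y₁, y₂)` of a product of two 2×2 determinants, one in `g, g'` and one in `f, f'`. The antitone
scores give both determinants the same sign. -/
theorem lineConv_mul_deriv_deriv_le (hf : IsRegularDensity f) (hg : IsRegularDensity g)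
    (hfs : HasAntitoneScore f) (hgs : HasAntitoneScore g) (z : ℝ) :
    lineConv f g z * deriv (deriv (lineConv f g)) z ≤ deriv (lineConv f g) z ^ 2 := by
  obtain ⟨C, hC⟩ := hf.exists_bound
  obtain ⟨D, hD⟩ := hf.exists_bound_deriv
  have i00 := integrable_comp_sub_mul hf.measurable hC hg.integrable z
  have i01 := integrable_comp_sub_mul hf.measurable hC hg.integrable_deriv z
  have i10 := integrable_comp_sub_mul (measurable_deriv f) hD hg.integrable z
  have i11 := integrable_comp_sub_mul (measurable_deriv f) hD hg.integrable_deriv z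
  have j1 := i10.mul_prod i01
  have j2 := i00.mul_prod i11
  have j3 := i11.mul_prod i00
  have j4 := i01.mul_prod i10
  have key : 0 ≤ ∫ p : ℝ × ℝ, ((deriv f (z - p.1) * g p.1) * (f (z - p.2) * deriv g p.2) -
      (f (z - p.1) * g p.1) * (deriv f (z - p.2) * deriv g p.2)) +
      ((f (z - p.1) * deriv g p.1) * (deriv f (z - p.2) * g p.2) -
      (deriv f (z - p.1) * deriv g p.1) * (f (z - p.2) * g p.2)) ∂(volume.prod volume) := by
    refine integral_nonneg fun p => ?_
    have heq : ((deriv f (z - p.1) * g p.1) * (f (z - p.2) * deriv g p.2) -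
      (f (z - p.1) * g p.1) * (deriv f (z - p.2) * deriv g p.2)) +
      ((f (z - p.1) * deriv g p.1) * (deriv f (z - p.2) * g p.2) -
      (deriv f (z - p.1) * deriv g p.1) * (f (z - p.2) * g p.2)) =
      (g p.1 * deriv g p.2 - deriv g p.1 * g p.2) *
      (f (z - p.2) * deriv f (z - p.1) - deriv f (z - p.2) * f (z - p.1)) := by ring
    simp only [Pi.zero_apply]
    rw [heq]
    rcases le_total p.1 p.2 with h | h
    · exact mul_nonneg_of_nonpos_of_nonpos (sub_nonpos.2 (hgs _ _ h))
        (sub_nonpos.2 (hfs _ _ (by linarith)))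
    · have h1 := hgs _ _ h
      have h2 := hfs (z - p.1) (z - p.2) (by linarith)
      exact mul_nonneg (by linarith) (by linarith)
  rw [integral_add (by exact j1.sub j2) (by exact j4.sub j3), integral_sub j1 j2,
    integral_sub j4 j3] at key
  rw [integral_prod_mul (fun y => deriv f (z - y) * g y) (fun y => f (z - y) * deriv g y),
    integral_prod_mul (fun y => f (z - y) * g y) (fun y => deriv f (z - y) * deriv g y),
    integral_prod_mul (fun y => f (z - y) * deriv g y) (fun y => deriv f (z - y) * g y),
    integral_prod_mul (fun y => deriv f (z - y) * deriv g y) (fun y => f (z - y) * g y)] at key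
  have h1 := hf.lineConv_deriv hg z
  rw [hf.deriv_deriv_lineConv hg, hf.deriv_lineConv hg]
  unfold lineConv at h1 ⊢
  rw [h1] at key
  nlinarith [key]

theorem negLogDeriv₂_lineConv_nonneg (hf : IsRegularDensity f) (hg : IsRegularDensity g)
    (hfs : HasAntitoneScore f) (hgs : HasAntitoneScore g) (z : ℝ) :
    0 ≤ negLogDeriv₂ (lineConv f g) z := by
  rcases (hf.lineConv_nonneg hg z).eq_or_lt with h | h
  · simp [negLogDeriv₂, ← h]
  · have := hf.lineConv_mul_deriv_deriv_le hg hfs hgs z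
    rw [negLogDeriv₂, div_pow, sub_nonneg, div_le_div_iff₀ h (by positivity)]
    nlinarith

/-- The variance inequality: `-(log h)''` for a convolution `h` is at most a conditional
expectation. -/
theorem negLogDeriv₂_lineConv_le (hf : IsRegularDensity f) (hg : IsRegularDensity g) {a b : ℝ}
    (hab : a + b = 1) {z : ℝ} (hz : 0 < lineConv f g z) :
    negLogDeriv₂ (lineConv f g) z * lineConv f g z ≤
      ∫ y, (a ^ 2 * negLogDeriv₂ f (z - y) + b ^ 2 * negLogDeriv₂ g y) * (f (z - y) * g y) := by
  obtain ⟨C, hC⟩ := hf.exists_bound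
  obtain ⟨D, hD⟩ := hf.exists_bound_deriv
  obtain ⟨G, hG⟩ := hg.exists_bound
  -- The score of the convolution at `z`, which is the conditional mean of `a ρ_f + b ρ_g`.
  set c : ℝ := deriv (lineConv f g) z / lineConv f g z with hc
  have i00 := integrable_comp_sub_mul hf.measurable hC hg.integrable z
  have i01 := integrable_comp_sub_mul hf.measurable hC hg.integrable_deriv z
  have i10 := integrable_comp_sub_mul (measurable_deriv f) hD hg.integrable z
  have i11 := integrable_comp_sub_mul (measurable_deriv f) hD hg.integrable_deriv z
  have i20 := integrable_comp_sub_mul' hf.integrable_deriv_deriv hg.measurable hG z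
  have i02 := integrable_comp_sub_mul hf.measurable hC hg.integrable_deriv_deriv z
  have k1 := integrable_comp_sub_mul' hf.integrable_negLogDeriv₂_mul hg.measurable hG z
  have k2 := integrable_comp_sub_mul hf.measurable hC hg.integrable_negLogDeriv₂_mul z
  have iM : Integrable fun y =>
      (a ^ 2 * negLogDeriv₂ f (z - y) + b ^ 2 * negLogDeriv₂ g y) * (f (z - y) * g y) := by
    refine ((k1.const_mul (a ^ 2)).add (k2.const_mul (b ^ 2))).congr
      (Eventually.of_forall fun y => ?_)
    simp only [Pi.add_apply]
    ring
  have hpt : ∀ᵐ y, 0 ≤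
      (a ^ 2 * negLogDeriv₂ f (z - y) + b ^ 2 * negLogDeriv₂ g y) * (f (z - y) * g y) +
      (a ^ 2 * (deriv (deriv f) (z - y) * g y) + (2 * a * b * (deriv f (z - y) * deriv g y) +
      (b ^ 2 * (f (z - y) * deriv (deriv g) y) + (-(2 * c * a) * (deriv f (z - y) * g y) +
      (-(2 * c * b) * (f (z - y) * deriv g y) + c ^ 2 * (f (z - y) * g y)))))) := by
    have hf1 : ∀ᵐ y, negLogDeriv₂ f (z - y) * f (z - y) =
        deriv f (z - y) ^ 2 / f (z - y) - deriv (deriv f) (z - y) :=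
      (Measure.measurePreserving_sub_left volume z).quasiMeasurePreserving.ae
        hf.ae_negLogDeriv₂_mul
    filter_upwards [hf1, hg.ae_negLogDeriv₂_mul] with y hy1 hy2
    have heq : (a ^ 2 * negLogDeriv₂ f (z - y) + b ^ 2 * negLogDeriv₂ g y) * (f (z - y) * g y) =
        a ^ 2 * (negLogDeriv₂ f (z - y) * f (z - y)) * g y +
        b ^ 2 * f (z - y) * (negLogDeriv₂ g y * g y) := by ring
    rw [heq, hy1, hy2]
    by_cases h1 : f (z - y) = 0
    · simp [h1, hf.deriv_eq_zero h1, mul_assoc]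
    by_cases h2 : g y = 0
    · simp [h2, hg.deriv_eq_zero h2, mul_assoc]
    have hfp := (hf.nonneg (z - y)).lt_of_ne' h1
    have hgp := (hg.nonneg y).lt_of_ne' h2
    -- The integrand is exactly `(a ρ_f + b ρ_g - c)² f g`; its integral is `h(z)` times the
    -- conditional variance.
    have hsq : 0 ≤ (a * deriv f (z - y) * g y + b * f (z - y) * deriv g y -
      c * f (z - y) * g y) ^ 2 / (f (z - y) * g y) := by positivity
    convert hsq using 1
    field_simp
    ring
  have key := integral_nonneg_of_ae hpt
  have e1 := i00.const_mul (c ^ 2)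
  have e2 := i01.const_mul (-(2 * c * b))
  have e3 := i10.const_mul (-(2 * c * a))
  have e4 := i02.const_mul (b ^ 2)
  have e5 := i11.const_mul (2 * a * b)
  have e6 := i20.const_mul (a ^ 2)
  have s2 := e2.add e1
  have s3 := e3.add s2
  have s4 := e4.add s3
  have s5 := e5.add s4
  have s6 := e6.add s5
  rw [integral_add iM (by exact s6), integral_add e6 (by exact s5), integral_add e5 (by exact s4),
    integral_add e4 (by exact s3), integral_add e3 (by exact s2), integral_add e2 e1] at key
  simp only [integral_const_mul] at key
  have r1 := hf.lineConv_deriv_deriv_left hg z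
  have r2 := hf.lineConv_deriv_deriv_right hg z
  have r3 := hf.lineConv_deriv hg z
  have r4 := congrFun (hf.deriv_lineConv hg) z
  have r5 := congrFun (hf.deriv_deriv_lineConv hg) z
  set h0 := lineConv f g z with hh0
  set h1 := deriv (lineConv f g) z with hh1
  set h2 := deriv (deriv (lineConv f g)) z with hh2
  rw [← r5] at r1 r2
  rw [← r4] at r3
  unfold lineConv at r1 r2 r3 r4 r5 hh0
  rw [r1, r2, r3, ← r4, ← r5, ← hh0] at key
  have hch : c * h0 = h1 := by rw [hc]; field_simp
  have hL : negLogDeriv₂ (lineConv f g) z * h0 = c * h1 - h2 := by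
    have : negLogDeriv₂ (lineConv f g) z = (h1 / h0) ^ 2 - h2 / h0 := rfl
    rw [this, hc]
    field_simp
  rw [hL]
  -- With `a + b = 1`, the three forms of `h''` add up to one `h''` and the two forms of `h'` to one
  -- `h'`; since `c h = h'`, the remaining terms are `h'' - c h'`.
  have hb : b = 1 - a := by linarith
  subst hb
  nlinarith [key, congrArg (c * ·) hch]

end IsRegularDensity

/-! ### From log-concave laws to regular densities -/

theorem HasDerivAt.nonneg_of_le_right {φ : ℝ → ℝ} {d : ℝ} (hd : HasDerivAt φ d 0)
    (h : ∀ δ, 0 < δ → φ 0 ≤ φ δ) : 0 ≤ d := by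
  have h1 := (hasDerivWithinAt_iff_tendsto_slope' (s := Ioi (0 : ℝ)) (by simp)).1
    (hd.hasDerivWithinAt (s := Ioi 0))
  refine ge_of_tendsto h1 ?_
  filter_upwards [self_mem_nhdsWithin] with δ hδ
  rw [slope_def_field, sub_zero]
  exact div_nonneg (sub_nonneg.2 (h δ hδ)) (le_of_lt hδ)

/-- Both `x + δ` and `y` are convex combinations of `x` and `y + δ`, with interchanged weights.
Multiplying the two log-concavity inequalities makes the exponents add up to 1. -/
theorem LogConcave.mul_add_le_add_mul {f : ℝ → ℝ} (hf : LogConcave f) {x y δ : ℝ} (hxy : x ≤ y)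
    (hδ : 0 < δ) : f x * f (y + δ) ≤ f (x + δ) * f y := by
  obtain ⟨h0, hc⟩ := hf
  have hL : 0 < y - x + δ := by linarith
  set s : ℝ := (y - x) / (y - x + δ) with hs
  set t : ℝ := δ / (y - x + δ) with ht
  have hs0 : 0 ≤ s := div_nonneg (by linarith) hL.le
  have ht0 : 0 ≤ t := div_nonneg hδ.le hL.le
  have hst : s + t = 1 := by rw [hs, ht, ← add_div, div_self hL.ne']
  have e1 : s * x + t * (y + δ) = x + δ := by rw [hs, ht]; field_simp; ring
  have e2 : t * x + s * (y + δ) = y := by rw [hs, ht]; field_simp; ring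
  have h1 := hc x (y + δ) s t hs0 ht0 hst
  have h2 := hc x (y + δ) t s ht0 hs0 (by linarith)
  rw [e1] at h1
  rw [e2] at h2
  have ha : f x ^ s * f x ^ t = f x := by
    rw [← Real.rpow_add_of_nonneg (h0 x) hs0 ht0, hst, Real.rpow_one]
  have hb : f (y + δ) ^ t * f (y + δ) ^ s = f (y + δ) := by
    rw [← Real.rpow_add_of_nonneg (h0 _) ht0 hs0, add_comm t, hst, Real.rpow_one]
  calc f x * f (y + δ) = (f x ^ s * f x ^ t) * (f (y + δ) ^ t * f (y + δ) ^ s) := by rw [ha, hb]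
    _ = (f x ^ s * f (y + δ) ^ t) * (f x ^ t * f (y + δ) ^ s) := by ring
    _ ≤ _ := mul_le_mul h1 h2 (mul_nonneg (Real.rpow_nonneg (h0 _) _) (Real.rpow_nonneg (h0 _) _))
        (h0 _)

theorem IsDensityOf.ae_eq {f g : ℝ → ℝ} {μ : Measure ℝ} [IsFiniteMeasure μ]
    (hf : IsDensityOf f μ) (hg : IsDensityOf g μ) : f =ᵐ[volume] g := by
  obtain ⟨hf0, hfm, hfμ⟩ := hf
  obtain ⟨hg0, hgm, hgμ⟩ := hg
  have h : (fun x => ENNReal.ofReal (f x)) =ᵐ[volume] fun x => ENNReal.ofReal (g x) := by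
    refine (withDensity_eq_iff hfm.ennreal_ofReal.aemeasurable hgm.ennreal_ofReal.aemeasurable
      ?_).1 (hfμ.symm.trans hgμ)
    have := measure_ne_top μ univ
    rw [hfμ, withDensity_apply _ MeasurableSet.univ] at this
    simpa using this
  filter_upwards [h] with x hx
  exact (ENNReal.ofReal_eq_ofReal_iff (hf0 x) (hg0 x)).1 hx

/-- The smooth density agrees with the log-concave one only almost everywhere. After translating all
four points by almost any `ε` the values coincide; such `ε` are dense, and continuity allows `ε =
0`. -/
theorem LogConcave.mul_add_le_add_mul_of_ae_eq {f g : ℝ → ℝ} (hf : LogConcave f) (hfg : f =ᵐ[volume] g)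
    (hg : Continuous g) {x y δ : ℝ} (hxy : x ≤ y) (hδ : 0 < δ) :
    g x * g (y + δ) ≤ g (x + δ) * g y := by
  have hsh : ∀ c : ℝ, ∀ᵐ ε, f (c + ε) = g (c + ε) := fun c =>
    (measurePreserving_add_left volume c).quasiMeasurePreserving.ae hfg
  have hae : ∀ᵐ ε : ℝ, g (x + ε) * g (y + δ + ε) ≤ g (x + δ + ε) * g (y + ε) := by
    filter_upwards [hsh x, hsh (y + δ), hsh (x + δ), hsh y] with ε h1 h2 h3 h4
    rw [← h1, ← h2, ← h3, ← h4]
    have := hf.mul_add_le_add_mul (x := x + ε) (y := y + ε) (by linarith) hδ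
    rwa [add_right_comm x, add_right_comm y] at this
  have hcl : IsClosed {ε : ℝ | g (x + ε) * g (y + δ + ε) ≤ g (x + δ + ε) * g (y + ε)} :=
    isClosed_le (by fun_prop) (by fun_prop)
  have := (Measure.dense_of_ae hae).closure_eq
  rw [hcl.closure_eq] at this
  have h0 := this.symm ▸ mem_univ (0 : ℝ)
  simpa using h0

/-- The two sides agree at `δ = 0`, so their right derivatives there are ordered. -/
theorem hasAntitoneScore_of_mul_add_le_add_mul {f : ℝ → ℝ} (hd : Differentiable ℝ f)
    (h : ∀ x y δ, x ≤ y → 0 < δ → f x * f (y + δ) ≤ f (x + δ) * f y) : HasAntitoneScore f := by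
  intro x y hxy
  have h1 : ∀ c, HasDerivAt (fun δ => f (c + δ)) (deriv f c) 0 := fun c => by
    have := (hd (c + 0)).hasDerivAt.comp_const_add c 0
    rwa [add_zero] at this
  have h2 := ((h1 x).mul_const (f y)).sub ((h1 y).const_mul (f x))
  have := h2.nonneg_of_le_right fun δ hδ => by
    have := h x y δ hxy hδ
    simp only [Pi.sub_apply, add_zero]
    linarith
  linarith

/-- The function `δ ↦ f'(x) f(x + δ) - f(x) f'(x + δ)` vanishes at 0 and is nonnegative to the
right, so its derivative `f'(x)² - f(x) f''(x)` at 0 is nonnegative. -/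
theorem HasAntitoneScore.ae_negLogDeriv₂_nonneg {f : ℝ → ℝ} (hs : HasAntitoneScore f)
    (h0 : ∀ x, 0 ≤ f x) (hf : TwiceDiffAC f) : ∀ᵐ x, 0 ≤ negLogDeriv₂ f x := by
  have hac : LocallyAC (deriv f) := hf.2
  filter_upwards [hac.ae_hasDerivAt] with x hx
  rcases (h0 x).eq_or_lt with h | h
  · simp [negLogDeriv₂, ← h]
  have h1 : HasDerivAt (fun δ => f (x + δ)) (deriv f x) 0 := by
    have := (hf.1 (x + 0)).hasDerivAt.comp_const_add x 0
    rwa [add_zero] at this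
  have h2 : HasDerivAt (fun δ => deriv f (x + δ)) (deriv (deriv f) x) 0 := by
    rw [← add_zero x] at hx
    have := hx.comp_const_add x 0
    rwa [add_zero] at this
  have := ((h1.const_mul (deriv f x)).sub (h2.const_mul (f x))).nonneg_of_le_right fun δ hδ => by
    have := hs x (x + δ) (by linarith)
    simp only [Pi.sub_apply, add_zero]
    linarith
  rw [negLogDeriv₂, div_pow, sub_nonneg, div_le_div_iff₀ h (by positivity)]
  nlinarith

/-- A law with a log-concave density and finite entropy production has a regular density. -/
theorem exists_isRegularDensity {μ : Measure ℝ} [IsProbabilityMeasure μ]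
    (hlc : ∃ f : ℝ → ℝ, LogConcave f ∧ IsDensityOf f μ) (hJ : entropyProduction μ < ⊤) :
    ∃ f, IsRegularDensity f ∧ HasAntitoneScore f ∧ IsDensityOf f μ := by
  obtain ⟨f₀, hf₀, hd₀⟩ := hlc
  simp only [entropyProduction, iInf_lt_iff] at hJ
  obtain ⟨f, ⟨hd, h2⟩, hlt⟩ := hJ
  have hs : HasAntitoneScore f := hasAntitoneScore_of_mul_add_le_add_mul h2.1 fun x y δ hxy hδ =>
    hf₀.mul_add_le_add_mul_of_ae_eq (hd₀.ae_eq hd) h2.1.continuous hxy hδ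
  have hl : ∫⁻ x, ENNReal.ofReal (f x) = 1 := by
    have := measure_univ (μ := μ)
    rwa [hd.2.2, withDensity_apply _ MeasurableSet.univ, Measure.restrict_univ] at this
  have hi : Integrable f := by
    refine ⟨hd.2.1.aestronglyMeasurable, ?_⟩
    rw [hasFiniteIntegral_iff_ofReal (Eventually.of_forall hd.1), hl]
    exact ENNReal.one_lt_top
  refine ⟨f, ⟨hd.1, hi, ?_, h2, hs.ae_negLogDeriv₂_nonneg hd.1 h2, hlt⟩, hs, hd⟩
  rw [integral_eq_lintegral_of_nonneg_ae (Eventually.of_forall hd.1) hd.2.1.aestronglyMeasurable,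
    hl, ENNReal.toReal_one]

/-! ### Entropy production of the convolution -/

namespace IsRegularDensity

variable {f g : ℝ → ℝ}

theorem integrable_comp_sub_mul (hf : IsRegularDensity f) (hg : IsRegularDensity g) (z : ℝ) :
    Integrable fun y => f (z - y) * g y := by
  obtain ⟨C, hC⟩ := hf.exists_bound
  exact _root_.integrable_comp_sub_mul hf.measurable hC hg.integrable z

theorem isDensityOf_lineConv (hf : IsRegularDensity f) (hg : IsRegularDensity g)
    {μ ν : Measure ℝ} [SFinite μ] [SFinite ν] (hμ : IsDensityOf f μ) (hν : IsDensityOf g ν) :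
    IsDensityOf (lineConv f g) (μ.conv ν) := by
  refine ⟨hf.lineConv_nonneg hg, (hf.twiceDiffAC_lineConv hg).1.continuous.measurable, ?_⟩
  rw [Measure.conv_comm, hμ.2.2, hν.2.2,
    conv_withDensity_eq_lconvolution hν.2.1.ennreal_ofReal hμ.2.1.ennreal_ofReal]
  congr 1
  ext z
  rw [lconvolution_def, lineConv, ofReal_integral_eq_lintegral_ofReal
    (hf.integrable_comp_sub_mul hg z)
    (Eventually.of_forall fun y => mul_nonneg (hf.nonneg _) (hg.nonneg _))]
  refine lintegral_congr fun y => ?_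
  rw [ENNReal.ofReal_mul (hf.nonneg _), mul_comm, neg_add_eq_sub]

/-- The conditional bound on `φ_h` is squared by Jensen and integrated over `z`. The cross term
factors by independence. The bound is stated in `[0, ∞]` because finiteness for the convolution is a
consequence of it. -/
theorem lintegral_negLogDeriv₂_lineConv_le (hf : IsRegularDensity f) (hg : IsRegularDensity g)
    (hfs : HasAntitoneScore f) (hgs : HasAntitoneScore g) {a b : ℝ} (hab : a + b = 1) :
    entropyProductionDensity (lineConv f g) ≤ ENNReal.ofReal
      (a ^ 4 * (∫ x, negLogDeriv₂ f x ^ 2 * f x) + 2 * a ^ 2 * b ^ 2 *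
        ((∫ x, negLogDeriv₂ f x * f x) * ∫ x, negLogDeriv₂ g x * g x) +
        b ^ 4 * ∫ x, negLogDeriv₂ g x ^ 2 * g x) := by
  set wf : ℝ → ℝ := fun x => negLogDeriv₂ f x * f x with hwf
  set wg : ℝ → ℝ := fun x => negLogDeriv₂ g x * g x with hwg
  set qf : ℝ → ℝ := fun x => negLogDeriv₂ f x ^ 2 * f x with hqf
  set qg : ℝ → ℝ := fun x => negLogDeriv₂ g x ^ 2 * g x with hqg
  have iwf : Integrable wf := hf.integrable_negLogDeriv₂_mul
  have iwg : Integrable wg := hg.integrable_negLogDeriv₂_mul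
  obtain ⟨a1, b1, c1⟩ := integral_lineConv hf.integrable_sq hg.integrable
  obtain ⟨a2, b2, c2⟩ := integral_lineConv iwf iwg
  obtain ⟨a3, b3, c3⟩ := integral_lineConv hf.integrable hg.integrable_sq
  obtain ⟨a4, -, -⟩ := integral_lineConv iwf hg.integrable
  obtain ⟨a5, -, -⟩ := integral_lineConv hf.integrable iwg
  rw [hg.integral_eq_one, mul_one] at c1
  rw [hf.integral_eq_one, one_mul] at c3
  set Q : ℝ → ℝ := fun z => a ^ 4 * lineConv qf g z + 2 * a ^ 2 * b ^ 2 * lineConv wf wg z +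
    b ^ 4 * lineConv f qg z with hQ
  have iQ : Integrable Q :=
    ((b1.const_mul _).add (b2.const_mul _)).add (b3.const_mul _)
  have hint : ∫ z, Q z = a ^ 4 * (∫ x, qf x) + 2 * a ^ 2 * b ^ 2 *
      ((∫ x, wf x) * ∫ x, wg x) + b ^ 4 * ∫ x, qg x := by
    rw [← c1, ← c2, ← c3, ← integral_const_mul, ← integral_const_mul, ← integral_const_mul,
      ← integral_add (b1.const_mul _) (b2.const_mul _),
      ← integral_add (by exact (b1.const_mul _).add (b2.const_mul _)) (b3.const_mul _)]
  have hpt : ∀ᵐ z, negLogDeriv₂ (lineConv f g) z ^ 2 * lineConv f g z ≤ Q z := by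
    filter_upwards [a1, a2, a3, a4, a5] with z a1 a2 a3 a4 a5
    set t := negLogDeriv₂ (lineConv f g) z with ht
    have ht0 : 0 ≤ t := hf.negLogDeriv₂_lineConv_nonneg hg hfs hgs z
    have a0 := hf.integrable_comp_sub_mul hg z
    set N : ℝ → ℝ := fun y => f (z - y) * g y with hN
    set W : ℝ → ℝ := fun y => a ^ 2 * negLogDeriv₂ f (z - y) + b ^ 2 * negLogDeriv₂ g y with hW
    have iW : Integrable fun y => W y * N y := by
      refine ((a4.const_mul (a ^ 2)).add (a5.const_mul (b ^ 2))).congr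
        (Eventually.of_forall fun y => ?_)
      simp only [Pi.add_apply, hW, hN, hwf, hwg]
      ring
    have hWQ : (fun y => W y ^ 2 * N y) = fun y => a ^ 4 * (qf (z - y) * g y) +
        2 * a ^ 2 * b ^ 2 * (wf (z - y) * wg y) + b ^ 4 * (f (z - y) * qg y) := by
      ext y
      simp only [hW, hN, hwf, hwg, hqf, hqg]
      ring
    have i12 : Integrable fun y => a ^ 4 * (qf (z - y) * g y) +
        2 * a ^ 2 * b ^ 2 * (wf (z - y) * wg y) := (a1.const_mul _).add (a2.const_mul _)
    have iW2 : Integrable fun y => W y ^ 2 * N y := by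
      rw [hWQ]
      exact i12.add (a3.const_mul _)
    have hQz : ∫ y, W y ^ 2 * N y = Q z := by
      rw [hWQ, integral_add i12 (a3.const_mul _), integral_add (a1.const_mul _) (a2.const_mul _),
        integral_const_mul, integral_const_mul, integral_const_mul]
      rfl
    have hN0 : ∀ y, 0 ≤ N y := fun y => mul_nonneg (hf.nonneg _) (hg.nonneg _)
    have hh : ∫ y, N y = lineConv f g z := rfl
    rcases (hf.lineConv_nonneg hg z).eq_or_lt with h | h
    · rw [← h, mul_zero, ← hQz]
      exact integral_nonneg fun y => mul_nonneg (sq_nonneg _) (hN0 y)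
    -- Jensen by hand: expanding `∫ (W - t)² N ≥ 0` gives `Q z ≥ 2t ∫ W N - t² h(z)`. Since `t ≥ 0`,
    -- the bound `∫ W N ≥ t h(z)` may be inserted, which leaves `Q z ≥ t² h(z)`.
    · have hle : t * lineConv f g z ≤ ∫ y, W y * N y := hf.negLogDeriv₂_lineConv_le hg hab h
      have hsq : 0 ≤ ∫ y, (W y - t) ^ 2 * N y :=
        integral_nonneg fun y => mul_nonneg (sq_nonneg _) (hN0 y)
      have hexp : (fun y => (W y - t) ^ 2 * N y) =
          fun y => W y ^ 2 * N y - 2 * t * (W y * N y) + t ^ 2 * N y := by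
        ext y; ring
      have i3 : Integrable fun y => W y ^ 2 * N y - 2 * t * (W y * N y) :=
        iW2.sub (iW.const_mul _)
      rw [hexp, integral_add i3 (a0.const_mul _), integral_sub iW2 (iW.const_mul _),
        integral_const_mul, integral_const_mul, hh, hQz] at hsq
      nlinarith
  rw [entropyProductionDensity_eq (hf.lineConv_nonneg hg)
    (hf.twiceDiffAC_lineConv hg).1.continuous.measurable, ← hint,
    ofReal_integral_eq_lintegral_ofReal iQ ?_]
  · refine lintegral_mono_ae ?_
    filter_upwards [hpt] with z hz
    exact ENNReal.ofReal_le_ofReal hz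
  · filter_upwards [hpt] with z hz
    exact (mul_nonneg (sq_nonneg _) (hf.lineConv_nonneg hg z)).trans hz

theorem convolution (hf : IsRegularDensity f) (hg : IsRegularDensity g)
    (hfs : HasAntitoneScore f) (hgs : HasAntitoneScore g) : IsRegularDensity (lineConv f g) where
  nonneg := hf.lineConv_nonneg hg
  integrable := (integral_lineConv hf.integrable hg.integrable).2.1
  integral_eq_one := by
    rw [(integral_lineConv hf.integrable hg.integrable).2.2, hf.integral_eq_one,
      hg.integral_eq_one, one_mul]
  twiceDiffAC := hf.twiceDiffAC_lineConv hg
  negLogDeriv₂_nonneg := Eventually.of_forall (hf.negLogDeriv₂_lineConv_nonneg hg hfs hgs)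
  -- Any weights would do; these bound the entropy production of the convolution by that of `f`.
  lt_top := (hf.lintegral_negLogDeriv₂_lineConv_le hg hfs hgs (a := 1) (b := 0)
    (by norm_num)).trans_lt ENNReal.ofReal_lt_top

theorem integral_sq_lineConv_le (hf : IsRegularDensity f) (hg : IsRegularDensity g)
    (hfs : HasAntitoneScore f) (hgs : HasAntitoneScore g) {a b : ℝ} (hab : a + b = 1) :
    ∫ x, negLogDeriv₂ (lineConv f g) x ^ 2 * lineConv f g x ≤
      a ^ 4 * (∫ x, negLogDeriv₂ f x ^ 2 * f x) + 2 * a ^ 2 * b ^ 2 *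
        ((∫ x, negLogDeriv₂ f x * f x) * ∫ x, negLogDeriv₂ g x * g x) +
        b ^ 4 * ∫ x, negLogDeriv₂ g x ^ 2 * g x := by
  have h := hf.lintegral_negLogDeriv₂_lineConv_le hg hfs hgs hab
  rw [(hf.convolution hg hfs hgs).entropyProductionDensity_eq_ofReal] at h
  refine (ENNReal.ofReal_le_ofReal_iff ?_).1 h
  have h1 := hf.integral_sq_pos
  have h2 := hg.integral_sq_pos
  have h3 := hf.integral_negLogDeriv₂_mul_nonneg
  have h4 := hg.integral_negLogDeriv₂_mul_nonneg
  positivity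

/-! ### Gaussian densities -/

/-- A regular density with constant `-(log f)''` on its support is a Gaussian density. -/
theorem exists_eq_gaussianPDFReal (hf : IsRegularDensity f) {c : ℝ} (hc : 0 < c)
    (h : ∀ᵐ x, f x ≠ 0 → negLogDeriv₂ f x = c) :
    ∃ (m : ℝ) (v : ℝ≥0), v ≠ 0 ∧ f = gaussianPDFReal m v := by
  obtain ⟨x₀, hx₀⟩ : ∃ x, f x ≠ 0 := by
    by_contra! hall
    have := hf.integral_eq_one
    simp [hall] at this
  have hp₀ : 0 < f x₀ := (hf.nonneg x₀).lt_of_ne' hx₀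
  -- The centre is determined by the Gaussian score equation `f'/f = c (m - x)` at `x₀`.
  set m : ℝ := x₀ + deriv f x₀ / f x₀ / c with hm
  set E : ℝ → ℝ := fun x => Real.exp (c * (x - m) ^ 2 / 2) with hE
  have hEpos : ∀ x, 0 < E x := fun x => Real.exp_pos _
  have hEd : ∀ x, HasDerivAt E (E x * (c * (x - m))) x := by
    intro x
    have h1 : HasDerivAt (fun x => c * (x - m) ^ 2 / 2) (c * (x - m)) x := by
      have := ((((hasDerivAt_id x).sub_const m).pow 2).const_mul c).div_const 2
      refine this.congr_deriv ?_
      simp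
      ring
    exact h1.exp
  have hEc : Continuous E := by fun_prop
  set A : ℝ := f x₀ * E x₀ with hA
  have hApos : 0 < A := mul_pos hp₀ (hEpos _)
  -- Positivity of `f` is known only at `x₀`, so the equation is propagated by connectedness. On `S`
  -- the value `f = A / E` is positive, which lets the argument continue past every point of `S`.
  set S : Set ℝ := {x | f x * E x = A ∧ deriv f x = c * (m - x) * f x} with hS
  have hS0 : x₀ ∈ S := by
    refine ⟨rfl, ?_⟩
    rw [hm]; field_simp; ring
  have hcont := hf.continuous
  have hcont' := hf.continuous_deriv
  have hclosed : IsClosed S :=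
    (isClosed_eq (by fun_prop) continuous_const).inter (isClosed_eq (by fun_prop) (by fun_prop))
  have hopen : IsOpen S := by
    rw [isOpen_iff_mem_nhds]
    intro x hx
    have hfx : 0 < f x := by
      refine (hf.nonneg x).lt_of_ne' fun h0 => ?_
      have := hx.1
      rw [h0, zero_mul] at this
      exact hApos.ne this
    obtain ⟨r, hr, hball⟩ := Metric.mem_nhds_iff.1
      (hcont.continuousAt.eventually (lt_mem_nhds hfx))
    -- The score `f'/f` has derivative `-c` only almost everywhere; its absolute continuity near
    -- `x`, where `f > 0`, makes it affine.
    have hder : ∀ y ∈ Metric.ball x r, deriv f y = c * (m - y) * f y := by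
      intro y hy
      have hsub : uIcc x y ⊆ Metric.ball x r := by
        rw [← segment_eq_uIcc]
        exact (convex_ball x r).segment_subset (Metric.mem_ball_self hr) hy
      have hpos : ∀ w ∈ uIcc x y, 0 < f w := fun w hw => hball (hsub hw)
      have hac : AbsolutelyContinuousOnInterval (fun w => (f w)⁻¹) x y := by
        refine ContDiffOn.absolutelyContinuousOnInterval ?_
        exact ((contDiff_one_iff_deriv.2 ⟨hf.differentiable, hcont'⟩).contDiffOn).inv
          fun w hw => (hpos w hw).ne'
      have hmul := ((hf.locallyAC_deriv x y).mul hac).integral_deriv_eq_sub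
      have hae : ∀ᵐ w, w ∈ uIoc x y → deriv (deriv f * fun w => (f w)⁻¹) w = -c := by
        filter_upwards [h, hf.locallyAC_deriv.ae_hasDerivAt] with w hw hdw hwm
        have hwp := hpos w (uIoc_subset_uIcc hwm)
        have h1 := (hdw.mul ((hf.hasDerivAt w).inv hwp.ne')).deriv
        rw [← hw hwp.ne', negLogDeriv₂]
        refine h1.trans ?_
        simp only [Pi.inv_apply]
        field_simp
        ring
      rw [intervalIntegral.integral_congr_ae hae, intervalIntegral.integral_const] at hmul
      simp only [Pi.mul_apply, smul_eq_mul] at hmul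
      have hy' := hpos y right_mem_uIcc
      have hxs := hx.2
      rw [hxs] at hmul
      field_simp at hmul
      linarith
    have hconst : ∀ y ∈ Metric.ball x r, f y * E y = f x * E x := by
      intro y hy
      refine Metric.isOpen_ball.is_const_of_deriv_eq_zero (𝕜 := ℝ) (f := fun y => f y * E y)
        (convex_ball x r).isPreconnected
        (fun w _ => ((hf.hasDerivAt w).mul (hEd w)).differentiableAt.differentiableWithinAt)
        (fun w hw => ?_) hy (Metric.mem_ball_self hr)
      refine ((hf.hasDerivAt w).mul (hEd w)).deriv.trans ?_
      rw [hder w hw, Pi.zero_apply]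
      ring
    filter_upwards [Metric.ball_mem_nhds x hr] with y hy
    exact ⟨(hconst y hy).trans hx.1, hder y hy⟩
  have huniv : S = univ := IsClopen.eq_univ ⟨hclosed, hopen⟩ ⟨x₀, hS0⟩
  obtain ⟨v, hvc⟩ : ∃ v : ℝ≥0, (v : ℝ) = c⁻¹ := ⟨⟨c⁻¹, by positivity⟩, rfl⟩
  have hv0 : v ≠ 0 := by
    rw [← NNReal.coe_ne_zero, hvc]
    positivity
  refine ⟨m, v, hv0, ?_⟩
  have hsqrt : 0 < √(2 * Real.pi * v) := by
    have : 0 < (v : ℝ) := by rw [hvc]; positivity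
    have := Real.pi_pos
    positivity
  have heq : ∀ x, f x = A * √(2 * Real.pi * v) * gaussianPDFReal m v x := by
    intro x
    have hx : x ∈ S := huniv ▸ mem_univ x
    rw [gaussianPDFReal, hvc]
    have hexp : Real.exp (-(x - m) ^ 2 / (2 * c⁻¹)) = (E x)⁻¹ := by
      rw [hE, ← Real.exp_neg]
      congr 1
      field_simp
    rw [hexp, ← hx.1]
    have h1 := (hEpos x).ne'
    rw [hvc] at hsqrt
    field_simp
  have hone : A * √(2 * Real.pi * v) = 1 := by
    have h1 := hf.integral_eq_one
    rw [integral_congr_ae (Eventually.of_forall heq), integral_const_mul,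
      integral_gaussianPDFReal_eq_one m hv0, mul_one] at h1
    exact h1
  ext x
  rw [heq x, hone, one_mul]

end IsRegularDensity

theorem isDensityOf_gaussianPDFReal (m : ℝ) {v : ℝ≥0} (hv : v ≠ 0) :
    IsDensityOf (gaussianPDFReal m v) (gaussianReal m v) :=
  ⟨gaussianPDFReal_nonneg m v, measurable_gaussianPDFReal m v, gaussianReal_of_var_ne_zero m hv⟩

theorem hasDerivAt_gaussianPDFReal (m : ℝ) (v : ℝ≥0) (x : ℝ) :
    HasDerivAt (gaussianPDFReal m v) (-((x - m) / v) * gaussianPDFReal m v x) x := by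
  have h1 : HasDerivAt (fun x => -(x - m) ^ 2 / (2 * v)) (-((x - m) / v)) x := by
    have := (((hasDerivAt_id x).sub_const m).pow 2).neg.div_const (2 * (v : ℝ))
    refine this.congr_deriv ?_
    simp only [id, Nat.cast_ofNat, Nat.add_one_sub_one, pow_one, mul_one]
    rw [← mul_neg, mul_div_mul_left _ _ two_ne_zero, neg_div]
  refine (h1.exp.const_mul (√(2 * Real.pi * v))⁻¹).congr_deriv ?_
  rw [gaussianPDFReal]
  ring

/-- The entropy production of a Gaussian law is the inverse square of its variance. -/
theorem entropyProduction_gaussianReal (m : ℝ) {v : ℝ≥0} (hv : v ≠ 0) :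
    entropyProduction (gaussianReal m v) = ENNReal.ofReal ((1 / (v : ℝ)) ^ 2) := by
  have hv' : (v : ℝ) ≠ 0 := by exact_mod_cast hv
  set q := gaussianPDFReal m v with hq
  have hd : deriv q = fun x => -((x - m) / v) * q x :=
    funext fun x => (hasDerivAt_gaussianPDFReal m v x).deriv
  have hdd : ∀ x, HasDerivAt (deriv q)
      (-(1 / v) * q x + -((x - m) / v) * (-((x - m) / v) * q x)) x := by
    intro x
    rw [hd]
    exact (((hasDerivAt_id x).sub_const m).div_const (v : ℝ)).neg.mul
      (hasDerivAt_gaussianPDFReal m v x)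
  have hdiff : Differentiable ℝ q :=
    fun x => (hasDerivAt_gaussianPDFReal m v x).differentiableAt
  have hac : LocallyAC (deriv q) := by
    refine .of_contDiff (contDiff_one_iff_deriv.2 ⟨fun x => (hdd x).differentiableAt, ?_⟩)
    rw [show deriv (deriv q) = _ from funext fun x => (hdd x).deriv]
    have := hdiff.continuous
    fun_prop
  have hn : ∀ x, negLogDeriv₂ q x = 1 / v := by
    intro x
    have hqx : q x ≠ 0 := (gaussianPDFReal_pos m v x hv).ne'
    rw [negLogDeriv₂, (hdd x).deriv, (hasDerivAt_gaussianPDFReal m v x).deriv]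
    field_simp
    ring
  rw [entropyProduction_eq (isDensityOf_gaussianPDFReal m hv) ⟨hdiff, hac⟩,
    entropyProductionDensity_eq (gaussianPDFReal_nonneg m v) (measurable_gaussianPDFReal m v)]
  simp only [← hq, hn]
  rw [lintegral_congr fun x => ENNReal.ofReal_mul (sq_nonneg (1 / (v : ℝ))),
    lintegral_const_mul' _ _ ENNReal.ofReal_ne_top, lintegral_gaussianPDFReal_eq_one m hv, mul_one]

theorem one_div_sqrt_entropyProduction_gaussianReal (m : ℝ) {v : ℝ≥0} (hv : v ≠ 0) :
    1 / √(entropyProduction (gaussianReal m v)).toReal = v := by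
  rw [entropyProduction_gaussianReal m hv, ENNReal.toReal_ofReal (sq_nonneg _),
    Real.sqrt_sq (by positivity), one_div_one_div]

/-! ### The optimal weights, equality and the theorem -/

/-- Minimising `(a² A + b² B)²` over `a + b = 1`, with the equality case. -/
theorem one_div_add_one_div_le {A B F G H : ℝ} (hA : 0 < A) (hB : 0 < B) (hH : 0 < H)
    (hF : 0 ≤ F) (hG : 0 ≤ G) (hFA : F ≤ A) (hGB : G ≤ B)
    (h : ∀ a b : ℝ, a + b = 1 → H ^ 2 ≤ a ^ 4 * A ^ 2 + 2 * a ^ 2 * b ^ 2 * (F * G) +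
      b ^ 4 * B ^ 2) :
    1 / A + 1 / B ≤ 1 / H ∧ (1 / H = 1 / A + 1 / B → F = A ∧ G = B) := by
  have hS : 0 < A + B := by positivity
  -- These weights minimise `a² A + b² B`, with value `A B / (A + B)`. The gap `A B - F G` then
  -- enters with a strictly positive coefficient, so equality forces `F G = A B`.
  have h1 := h (B / (A + B)) (A / (A + B)) (by field_simp; ring)
  have hFG : F * G ≤ A * B := mul_le_mul hFA hGB hG hA.le
  have hexp : (B / (A + B)) ^ 4 * A ^ 2 + 2 * (B / (A + B)) ^ 2 * (A / (A + B)) ^ 2 * (F * G) +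
      (A / (A + B)) ^ 4 * B ^ 2 = (A * B / (A + B)) ^ 2 -
        2 * (B / (A + B)) ^ 2 * (A / (A + B)) ^ 2 * (A * B - F * G) := by
    field_simp
    ring
  rw [hexp] at h1
  have hw : 0 < 2 * (B / (A + B)) ^ 2 * (A / (A + B)) ^ 2 := by positivity
  have hsum : 1 / A + 1 / B = 1 / (A * B / (A + B)) := by field_simp; ring
  constructor
  · rw [hsum]
    refine one_div_le_one_div_of_le hH ?_
    refine le_of_sq_le_sq ?_ (by positivity)
    nlinarith [mul_nonneg hw.le (sub_nonneg.2 hFG)]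
  · intro heq
    rw [hsum, one_div, one_div, inv_inj] at heq
    rw [heq] at h1
    have hge : A * B ≤ F * G := by
      by_contra! hlt
      nlinarith [mul_pos hw (sub_pos.2 hlt)]
    constructor
    · by_contra hne
      have : F < A := lt_of_le_of_ne hFA hne
      nlinarith [mul_pos (sub_pos.2 this) hB, mul_nonneg hF (sub_nonneg.2 hGB)]
    · by_contra hne
      have : G < B := lt_of_le_of_ne hGB hne
      nlinarith [mul_pos (sub_pos.2 this) hA, mul_nonneg hG (sub_nonneg.2 hFA)]

/-- This is equality in Cauchy–Schwarz: `φ_f` has mean `c` and second moment `c²` under `f`, so it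
equals `c` almost everywhere on the support. -/
theorem IsRegularDensity.exists_eq_gaussianPDFReal_of_integral_eq_sqrt {f : ℝ → ℝ}
    (hf : IsRegularDensity f)
    (h : ∫ x, negLogDeriv₂ f x * f x = √(∫ x, negLogDeriv₂ f x ^ 2 * f x)) :
    ∃ (m : ℝ) (v : ℝ≥0), v ≠ 0 ∧ f = gaussianPDFReal m v := by
  have hpos := hf.integral_sq_pos
  set c := √(∫ x, negLogDeriv₂ f x ^ 2 * f x) with hc
  have hcc : c ^ 2 = ∫ x, negLogDeriv₂ f x ^ 2 * f x := Real.sq_sqrt hpos.le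
  obtain ⟨hi, he⟩ := hf.integral_sub_sq_mul c
  refine hf.exists_eq_gaussianPDFReal (Real.sqrt_pos.2 hpos) ?_
  have hz : ∫ x, (negLogDeriv₂ f x - c) ^ 2 * f x = 0 := by
    rw [he, h, ← hcc]
    ring
  have hae := (integral_eq_zero_iff_of_nonneg
    (fun x => mul_nonneg (sq_nonneg _) (hf.nonneg x)) hi).1 hz
  filter_upwards [hae] with x hx hfx
  simp only [Pi.zero_apply, mul_eq_zero, hfx, or_false] at hx
  exact sub_eq_zero.1 (pow_eq_zero_iff two_ne_zero |>.1 hx)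

theorem IsRegularDensity.entropyProduction_eq_ofReal {f : ℝ → ℝ} {μ : Measure ℝ}
    [IsFiniteMeasure μ] (hf : IsRegularDensity f) (hμ : IsDensityOf f μ) :
    entropyProduction μ = ENNReal.ofReal (∫ x, negLogDeriv₂ f x ^ 2 * f x) := by
  rw [entropyProduction_eq hμ hf.twiceDiffAC, hf.entropyProductionDensity_eq_ofReal]

theorem IsDensityOf.eq_gaussianReal {μ : Measure ℝ} {m : ℝ} {v : ℝ≥0} (hv : v ≠ 0)
    (h : IsDensityOf (gaussianPDFReal m v) μ) : μ = gaussianReal m v := by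
  rw [h.2.2, (isDensityOf_gaussianPDFReal m hv).2.2]

theorem corollary1 {Ω : Type*} [MeasurableSpace Ω] (P : Measure Ω) [IsProbabilityMeasure P]
    (X Y : Ω → ℝ) (hX : AEMeasurable X P) (hY : AEMeasurable Y P) (hXY : IndepFun X Y P)
    (hlcX : ∃ f : ℝ → ℝ, LogConcave f ∧ IsDensityOf f (P.map X))
    (hlcY : ∃ g : ℝ → ℝ, LogConcave g ∧ IsDensityOf g (P.map Y))
    (hJX : entropyProduction (P.map X) < ⊤) (hJY : entropyProduction (P.map Y) < ⊤) :
    (0 < entropyProduction (P.map X) ∧ 0 < entropyProduction (P.map Y) ∧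
      0 < entropyProduction (P.map (X + Y)) ∧ entropyProduction (P.map (X + Y)) < ⊤) ∧
    1 / √(entropyProduction (P.map (X + Y))).toReal ≥
      1 / √(entropyProduction (P.map X)).toReal + 1 / √(entropyProduction (P.map Y)).toReal ∧
    (1 / √(entropyProduction (P.map (X + Y))).toReal =
        1 / √(entropyProduction (P.map X)).toReal + 1 / √(entropyProduction (P.map Y)).toReal ↔
      (∃ (m : ℝ) (v : ℝ≥0), v ≠ 0 ∧ P.map X = gaussianReal m v) ∧
      (∃ (m : ℝ) (v : ℝ≥0), v ≠ 0 ∧ P.map Y = gaussianReal m v)) := by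
  have := Measure.isProbabilityMeasure_map hX
  have := Measure.isProbabilityMeasure_map hY
  have := Measure.isProbabilityMeasure_map (hX.add hY)
  obtain ⟨f, hf, hfs, hfX⟩ := exists_isRegularDensity hlcX hJX
  obtain ⟨g, hg, hgs, hgY⟩ := exists_isRegularDensity hlcY hJY
  have hh := hf.convolution hg hfs hgs
  have hhXY : IsDensityOf (lineConv f g) (P.map (X + Y)) := by
    rw [hXY.map_add_eq_map_conv_map₀ hX hY]
    exact hf.isDensityOf_lineConv hg hfX hgY
  have eX := hf.entropyProduction_eq_ofReal hfX
  have eY := hg.entropyProduction_eq_ofReal hgY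
  have eXY := hh.entropyProduction_eq_ofReal hhXY
  have pX := hf.integral_sq_pos
  have pY := hg.integral_sq_pos
  have pXY := hh.integral_sq_pos
  have hmain := one_div_add_one_div_le (Real.sqrt_pos.2 pX) (Real.sqrt_pos.2 pY)
    (Real.sqrt_pos.2 pXY) hf.integral_negLogDeriv₂_mul_nonneg hg.integral_negLogDeriv₂_mul_nonneg
    (Real.le_sqrt_of_sq_le hf.sq_integral_le) (Real.le_sqrt_of_sq_le hg.sq_integral_le)
    (fun a b hab => by
      rw [Real.sq_sqrt pX.le, Real.sq_sqrt pY.le, Real.sq_sqrt pXY.le]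
      exact hf.integral_sq_lineConv_le hg hfs hgs hab)
  refine ⟨?_, ?_, ?_, ?_⟩
  · rw [eX, eY, eXY]
    exact ⟨ENNReal.ofReal_pos.2 pX, ENNReal.ofReal_pos.2 pY, ENNReal.ofReal_pos.2 pXY,
      ENNReal.ofReal_lt_top⟩
  · rw [eX, eY, eXY, ENNReal.toReal_ofReal pX.le, ENNReal.toReal_ofReal pY.le,
      ENNReal.toReal_ofReal pXY.le]
    exact hmain.1
  · intro heq
    rw [eX, eY, eXY, ENNReal.toReal_ofReal pX.le, ENNReal.toReal_ofReal pY.le,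
      ENNReal.toReal_ofReal pXY.le] at heq
    obtain ⟨h1, h2⟩ := hmain.2 heq
    obtain ⟨m, v, hv, rfl⟩ := hf.exists_eq_gaussianPDFReal_of_integral_eq_sqrt h1
    obtain ⟨m', v', hv', rfl⟩ := hg.exists_eq_gaussianPDFReal_of_integral_eq_sqrt h2
    exact ⟨⟨m, v, hv, hfX.eq_gaussianReal hv⟩, m', v', hv', hgY.eq_gaussianReal hv'⟩
  -- For a Gaussian law `1/√J` is the variance, and variances of independent variables add.
  · rintro ⟨⟨m, v, hv, hmX⟩, m', v', hv', hmY⟩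
    rw [gaussianReal_add_gaussianReal_of_indepFun hXY hmX hmY, hmX, hmY,
      one_div_sqrt_entropyProduction_gaussianReal _ hv,
      one_div_sqrt_entropyProduction_gaussianReal _ hv',
      one_div_sqrt_entropyProduction_gaussianReal _ (by simp [hv]), NNReal.coe_add]
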